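/- Let $1<p<\infty$ and let $p'$ be the conjugate exponent, $\frac1p+\frac1{p'}=1$. Let \[S_{p,p'}=\Big\{g\in L^2(\mathbb R^2)\;:\;\|g\|_{S_{p,p'}}^2:=\int_{\mathbb R^2}|\hat g(\xi_1,\xi_2)|^2\,\big(1+|\xi_1|^p+|\xi_2|^{p'}\big)\,d\xi_1\,d\xi_2<\infty\Big\},\] where functions are complex-valued and $\hat g$ is the Fourier transform of $g$ (normalised by $\hat g(\xi)=\int_{\mathbb R^2} g(x)e^{-2\pi i x\cdot\xi}\,dx$ for integrable $g$). Let $\mathrm{BMO}(\mathbb R^2)$ be the space of all $f\in L^1_{\mathrm{loc}}(\mathbb R^2)$ with \[\|f\|_{\mathrm{BMO}}:=\sup_Q\frac1{|Q|}\int_Q\Big|f(x)-\frac1{|Q|}\int_Q f\Big|\,dx<\infty,\] where the supremum is over all axis-parallel cubes (that is, squares) $Q\subset\mathbb R^2$, and let $\mathrm{VMO}(\mathbb R^2)$ be the closure in $\mathrm{BMO}(\mathbb R^2)$, with respect to $\|\cdot\|_{\mathrm{BMO}}$, of the uniformly continuous functions that belong to $\mathrm{BMO}(\mathbb R^2)$.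 Then $S_{p,p'}\subset\mathrm{VMO}(\mathbb R^2)$, and there is a finite constant $C$, depending only on $p$, such that \[\|f\|_{\mathrm{BMO}}\le C\,\|f\|_{S_{p,p'}}\qquad\text{for all } f\in S_{p,p'}.\] -/

import Mathlib

open MeasureTheory
open scoped ENNReal NNReal FourierTransform

namespace ZakVMO

/-- The closed axis-parallel cube in `ℝⁿ` with lower corner `a` and side length `l`. -/
def cube {n : ℕ} (a : EuclideanSpace ℝ (Fin n)) (l : ℝ) : Set (EuclideanSpace ℝ (Fin n)) :=
  {x | ∀ i, a i ≤ x i ∧ x i ≤ a i + l}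

/-- The mean oscillation `⨍_Q |f - ⨍_Q f|` of `f` over a set `Q`. -/
noncomputable def meanOscillation {n : ℕ} (f : EuclideanSpace ℝ (Fin n) → ℂ)
    (Q : Set (EuclideanSpace ℝ (Fin n))) : ℝ≥0∞ :=
  ⨍⁻ x in Q, ‖f x - ⨍ y in Q, f y ∂volume‖ₑ ∂volume

/-- The BMO (semi)norm: the supremum of the mean oscillations over all cubes, as an extended
nonnegative real. It is meaningful for locally integrable `f`. -/
noncomputable def bmoNorm {n : ℕ} (f : EuclideanSpace ℝ (Fin n) → ℂ) : ℝ≥0∞ :=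
  ⨆ (a : EuclideanSpace ℝ (Fin n)) (l : ℝ) (_ : 0 < l), meanOscillation f (cube a l)

/-- `f ∈ BMO(ℝⁿ)`: `f` is locally integrable with finite BMO norm. -/
def MemBMO {n : ℕ} (f : EuclideanSpace ℝ (Fin n) → ℂ) : Prop :=
  LocallyIntegrable f ∧ bmoNorm f < ∞

/-- `f ∈ VMO(ℝⁿ)`: `f` is in the closure, with respect to the BMO norm and within `BMO(ℝⁿ)`,
of the set of uniformly continuous functions. -/
def MemVMO {n : ℕ} (f : EuclideanSpace ℝ (Fin n) → ℂ) : Prop :=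
  MemBMO f ∧ ∀ ε : ℝ≥0∞, 0 < ε →
    ∃ g : EuclideanSpace ℝ (Fin n) → ℂ, UniformContinuous g ∧ MemBMO g ∧ bmoNorm (f - g) < ε

/-- The space `L²(ℝ²)` of complex-valued functions. -/
abbrev L2Plane : Type :=
  Lp (α := EuclideanSpace ℝ (Fin 2)) ℂ 2 volume

/-- The quantity `∫ |ĝ(ξ₁, ξ₂)|² (1 + |ξ₁|^p + |ξ₂|^q) dξ₁ dξ₂`, where `ĝ` is the (Plancherel)
Fourier transform of `g ∈ L²(ℝ²)`. -/
noncomputable def weightedEnergy (p q : ℝ) (g : L2Plane) : ℝ≥0∞ :=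
  ∫⁻ ξ, ‖(𝓕 g : L2Plane) ξ‖ₑ ^ 2 * ENNReal.ofReal (1 + |ξ 0| ^ p + |ξ 1| ^ q)

/-- The anisotropic Sobolev space `S_{p,q} ⊆ L²(ℝ²)`. -/
def sobolevSpace (p q : ℝ) : Set L2Plane :=
  {g | weightedEnergy p q g < ∞}

/-- The norm of `S_{p,q}`. -/
noncomputable def sobolevNorm (p q : ℝ) (g : L2Plane) : ℝ≥0∞ :=
  weightedEnergy p q g ^ (1 / 2 : ℝ)

end ZakVMO

namespace ZakVMO

/-! The inverse of the weight `1 + |ξ₁|^p + |ξ₂|^p'`, integrated along a line on which one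
coordinate is fixed at `a`, is at most a constant over `|a|`. This is a scaling computation that
works because the exponents are conjugate (`lintegral_inv_weight_le`), and it is all that the BMO
estimate uses of the weight (`IsCriticalWeight`).

Fix a square of side `l` and cut the frequency plane at `l⁻¹` in each coordinate. Where both
frequencies are low, weighted Cauchy–Schwarz bounds the integrals of `|ξᵢ| |F|`, so this part varies
by a bounded amount over the square (`IsCriticalWeight.enorm_prodFourierInv_sub_le`). Where `|ξ₁|`
is high, Cauchy–Schwarz in `ξ₂` and Plancherel in `x₁` bound the `L²` norm on each horizontal line;
averaging over the square cancels every power of `l` (`IsCriticalWeight.laverage_square_le`). The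
rest is the same with the coordinates exchanged.

This treats integrable `F`. A general `f` is approximated by cutting its Fourier transform off
outside balls: the cut-offs converge in `L²`, which carries the BMO bound over to `f`. They are
uniformly continuous by Riemann–Lebesgue and converge in the weighted norm, hence in BMO, which
gives VMO. -/

/-! ### Mean oscillation and Cauchy–Schwarz. -/

lemma lintegral_enorm_sub_integral_add_le {α : Type*} [MeasurableSpace α] {P : Measure α}
    {f g : α → ℂ} (hf : Integrable f P)
    (hg : Integrable g P) :
    ∫⁻ x, ‖(f x + g x) - ∫ y, (f y + g y) ∂P‖ₑ ∂P ≤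
      ∫⁻ x, ‖f x - ∫ y, f y ∂P‖ₑ ∂P + ∫⁻ x, ‖g x - ∫ y, g y ∂P‖ₑ ∂P := by
  have hm : AEMeasurable (fun x => ‖f x - ∫ y, f y ∂P‖ₑ) P :=
    (hf.aestronglyMeasurable.sub aestronglyMeasurable_const).enorm
  rw [integral_add hf hg, ← lintegral_add_left' hm]
  refine lintegral_mono fun x => ?_
  rw [add_sub_add_comm]
  exact enorm_add_le _ _

section Oscillation

variable {α : Type*} [MeasurableSpace α] {P : Measure α} [IsProbabilityMeasure P]

lemma lintegral_enorm_sub_integral_le_two_mul (f : α → ℂ) :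
    ∫⁻ x, ‖f x - ∫ y, f y ∂P‖ₑ ∂P ≤ 2 * ∫⁻ x, ‖f x‖ₑ ∂P := by
  calc ∫⁻ x, ‖f x - ∫ y, f y ∂P‖ₑ ∂P
      ≤ ∫⁻ x, (‖f x‖ₑ + ‖∫ y, f y ∂P‖ₑ) ∂P := lintegral_mono fun x => enorm_sub_le
    _ = ∫⁻ x, ‖f x‖ₑ ∂P + ‖∫ y, f y ∂P‖ₑ := by
        rw [lintegral_add_right _ measurable_const]; simp
    _ ≤ ∫⁻ x, ‖f x‖ₑ ∂P + ∫⁻ x, ‖f x‖ₑ ∂P := by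
        gcongr; exact enorm_integral_le_lintegral_enorm f
    _ = _ := (two_mul _).symm

/-- The deviation of `f x` from the mean is the mean over `y` of `f x - f y`. -/
lemma lintegral_enorm_sub_integral_le_of_forall {f : α → ℂ} (hf : Integrable f P) {Q : Set α}
    (hQ : ∀ᵐ x ∂P, x ∈ Q) {B : ℝ≥0∞} (hB : ∀ x ∈ Q, ∀ y ∈ Q, ‖f x - f y‖ₑ ≤ B) :
    ∫⁻ x, ‖f x - ∫ y, f y ∂P‖ₑ ∂P ≤ B := by
  have key : ∀ᵐ x ∂P, ‖f x - ∫ y, f y ∂P‖ₑ ≤ B := by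
    filter_upwards [hQ] with x hx
    have : f x - ∫ y, f y ∂P = ∫ y, (f x - f y) ∂P := by
      rw [integral_sub (integrable_const _) hf]; simp
    rw [this]
    calc _ ≤ ∫⁻ y, ‖f x - f y‖ₑ ∂P := enorm_integral_le_lintegral_enorm _
      _ ≤ ∫⁻ _, B ∂P := lintegral_mono_ae (by filter_upwards [hQ] with y hy using hB x hx y hy)
      _ = B := by simp
  calc _ ≤ ∫⁻ _, B ∂P := lintegral_mono_ae key
    _ = B := by simp

end Oscillation

/-- The Cauchy–Schwarz inequality with a weight. -/
lemma sq_lintegral_mul_le {α : Type*} [MeasurableSpace α] {μ : Measure α} {f g w : α → ℝ≥0∞}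
    (hf : AEMeasurable f μ) (hg : AEMeasurable g μ) (hw : AEMeasurable w μ)
    (hw0 : ∀ x, w x ≠ 0) (hwt : ∀ x, w x ≠ ∞) :
    (∫⁻ x, g x * f x ∂μ) ^ 2 ≤ (∫⁻ x, g x ^ 2 * (w x)⁻¹ ∂μ) * ∫⁻ x, f x ^ 2 * w x ∂μ := by
  have h := ENNReal.lintegral_mul_le_Lp_mul_Lq μ Real.HolderConjugate.two_two
    (f := fun x => g x * (w x ^ (1 / 2 : ℝ))⁻¹) (g := fun x => f x * w x ^ (1 / 2 : ℝ))
    (by fun_prop) (by fun_prop)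
  have e1 : ∀ x, (g x * (w x ^ (1 / 2 : ℝ))⁻¹) * (f x * w x ^ (1 / 2 : ℝ)) = g x * f x := by
    intro x
    have h0 : w x ^ (1 / 2 : ℝ) ≠ 0 := by simp [hw0 x, hwt x]
    have ht : w x ^ (1 / 2 : ℝ) ≠ ∞ := by simp [hwt x]
    calc _ = g x * f x * ((w x ^ (1 / 2 : ℝ))⁻¹ * w x ^ (1 / 2 : ℝ)) := by ring
      _ = _ := by rw [ENNReal.inv_mul_cancel h0 ht, mul_one]
  have e2 : ∀ x, (w x ^ (1 / 2 : ℝ)) ^ 2 = w x := by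
    intro x
    rw [← ENNReal.rpow_two, ← ENNReal.rpow_mul]; simp
  have e3 : ∀ y : ℝ≥0∞, (y ^ (1 / 2 : ℝ)) ^ 2 = y := by
    intro y
    rw [← ENNReal.rpow_two, ← ENNReal.rpow_mul]; simp
  simp only [Pi.mul_apply, e1, ENNReal.rpow_two, mul_pow, ← ENNReal.inv_pow, e2] at h
  calc _ ≤ _ := pow_le_pow_left' h 2
    _ = _ := by rw [mul_pow, e3, e3]

/-! ### Plancherel for the inverse Fourier integral. -/

section Fourier

variable {E : Type*} [NormedAddCommGroup E] [InnerProductSpace ℝ E] [FiniteDimensional ℝ E]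
  [MeasurableSpace E] [BorelSpace E]

lemma integral_fourierInv_smul_eq {g F : E → ℂ} (hg : Integrable g) (hF : Integrable F) :
    ∫ x, 𝓕⁻ g x • F x = ∫ x, g x • 𝓕⁻ F x := by
  have h := VectorFourier.integral_fourierIntegral_smul_eq_flip (μ := volume) (ν := volume)
    (L := -innerₗ E) (f := g) (g := F) Real.continuous_fourierChar
    (by simp only [LinearMap.neg_apply, innerₗ_apply_apply]; fun_prop) hg hF
  have : (-innerₗ E).flip = -innerₗ E := by
    ext x y; simp [real_inner_comm]
  rw [this] at h
  exact h

/-- Both sides have the same integrals against smooth compactly supported functions: the `L²`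
transform through its compatibility with tempered distributions, the integral through the
multiplication formula. -/
lemma fourierInv_toLp_ae_eq {F : E → ℂ} (hF : Integrable F) (hF2 : MemLp F 2) :
    (𝓕⁻ (hF2.toLp F) : Lp (α := E) ℂ 2 volume) =ᵐ[volume] 𝓕⁻ F := by
  have hcont : Continuous (𝓕⁻ F : E → ℂ) :=
    VectorFourier.fourierIntegral_continuous Real.continuous_fourierChar
      (by simp only [LinearMap.neg_apply, innerₗ_apply_apply]; fun_prop) hF
  refine ae_eq_of_integral_contDiff_smul_eq
    ((Lp.memLp _).locallyIntegrable (by norm_num)) hcont.locallyIntegrable ?_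
  intro g g_smooth g_cpt
  have hg₁ : HasCompactSupport (Complex.ofRealCLM ∘ g) := g_cpt.comp_left rfl
  have hg₂ : ContDiff ℝ ((⊤ : ℕ∞) : WithTop ℕ∞) (Complex.ofRealCLM ∘ g) :=
    Complex.ofRealCLM.contDiff.comp g_smooth
  set φ : SchwartzMap E ℂ := hg₁.toSchwartzMap hg₂ with hφ
  have hφx : ∀ x, φ x = (g x : ℂ) := fun x => rfl
  have h1 : ∫ x, φ x • (𝓕⁻ (hF2.toLp F) : Lp (α := E) ℂ 2 volume) x = ∫ x, (𝓕⁻ φ) x • F x := by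
    have := Lp.fourierInv_toTemperedDistribution_eq (hF2.toLp F)
    have h2 := congrArg (fun T => T φ) this
    simp only [TemperedDistribution.fourierInv_apply, Lp.toTemperedDistribution_apply] at h2
    rw [← h2]
    refine integral_congr_ae ?_
    filter_upwards [hF2.coeFn_toLp] with x hx
    rw [hx]
  have h3 : ∫ x, (𝓕⁻ φ) x • F x = ∫ x, φ x • 𝓕⁻ F x := by
    rw [SchwartzMap.fourierInv_coe]
    exact integral_fourierInv_smul_eq φ.integrable hF
  simpa [hφx] using h1.trans h3

lemma lintegral_enorm_sq_coeFn {α : Type*} [MeasurableSpace α] {μ : Measure α} (u : Lp ℂ 2 μ) :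
    ∫⁻ x, ‖u x‖ₑ ^ 2 ∂μ = ‖u‖ₑ ^ 2 := by
  rw [Lp.enorm_def, eLpNorm_eq_lintegral_rpow_enorm_toReal (by norm_num) (by norm_num)]
  simp only [ENNReal.toReal_ofNat, ENNReal.rpow_two]
  rw [← ENNReal.rpow_two, ← ENNReal.rpow_mul]; simp

/-- The part of Plancherel's theorem needed for integrable functions, with no
square-integrability assumption. -/
lemma lintegral_enorm_sq_fourierInv_le {F : E → ℂ} (hF : Integrable F) :
    ∫⁻ x, ‖𝓕⁻ F x‖ₑ ^ 2 ≤ ∫⁻ x, ‖F x‖ₑ ^ 2 := by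
  by_cases h : ∫⁻ x, ‖F x‖ₑ ^ 2 = ∞
  · simp [h]
  have hF2 : MemLp F 2 := by
    refine ⟨hF.aestronglyMeasurable, ?_⟩
    rw [eLpNorm_lt_top_iff_lintegral_rpow_enorm_lt_top (by norm_num) (by norm_num)]
    simpa using lt_top_iff_ne_top.2 h
  have hn : ‖(𝓕⁻ (hF2.toLp F) : Lp (α := E) ℂ 2 volume)‖ₑ = ‖hF2.toLp F‖ₑ := by
    rw [← ofReal_norm, ← ofReal_norm, ← Lp.norm_fourier_eq, FourierTransform.fourier_fourierInv_eq]
  have e1 := lintegral_enorm_sq_coeFn (𝓕⁻ (hF2.toLp F))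
  have e2 := lintegral_enorm_sq_coeFn (hF2.toLp F)
  rw [hn, ← e2] at e1
  refine le_of_eq ?_
  calc _ = ∫⁻ x, ‖(𝓕⁻ (hF2.toLp F) : Lp (α := E) ℂ 2 volume) x‖ₑ ^ 2 :=
        lintegral_congr_ae (by filter_upwards [fourierInv_toLp_ae_eq hF hF2] with x hx; rw [hx])
    _ = _ := e1
    _ = _ := lintegral_congr_ae (by filter_upwards [hF2.coeFn_toLp] with x hx; rw [hx])

end Fourier

/-! ### One-dimensional integrals of the inverse weight. -/

section Kernel

/-- Comparison with `(1 + |t|) ^ (-q)`, since `(1 + |t|) ^ q ≤ 2 ^ q * max 1 (|t| ^ q)`. -/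
lemma lintegral_inv_one_add_abs_rpow_lt_top {q : ℝ} (hq : 1 < q) :
    ∫⁻ t : ℝ, (ENNReal.ofReal (1 + |t| ^ q))⁻¹ < ∞ := by
  have h := finite_integral_one_add_norm (E := ℝ) (μ := volume) (r := q) (by simpa using hq)
  refine lt_of_le_of_lt (b := ENNReal.ofReal (2 ^ q) *
    ∫⁻ t : ℝ, ENNReal.ofReal ((1 + ‖t‖) ^ (-q))) ?_ (ENNReal.mul_lt_top (by simp) h)
  rw [← lintegral_const_mul _ (by fun_prop)]
  refine lintegral_mono fun t => ?_
  have ht : 0 ≤ |t| := abs_nonneg t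
  have hpos : 0 < 1 + |t| ^ q := by positivity
  rw [← ENNReal.ofReal_inv_of_pos hpos, ← ENNReal.ofReal_mul (by positivity)]
  apply ENNReal.ofReal_le_ofReal
  rw [Real.norm_eq_abs, Real.rpow_neg (by positivity), ← div_eq_mul_inv,
    inv_le_comm₀ hpos (by positivity), inv_div, div_le_iff₀ (by positivity)]
  rcases le_total |t| 1 with h1 | h1
  · calc (1 + |t|) ^ q ≤ 2 ^ q := by
          apply Real.rpow_le_rpow (by positivity) (by linarith) (by linarith)
      _ ≤ (1 + |t| ^ q) * 2 ^ q := le_mul_of_one_le_left (by positivity) (by simp; positivity)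
  · calc (1 + |t|) ^ q ≤ (|t| * 2) ^ q := by
          apply Real.rpow_le_rpow (by positivity) (by linarith) (by linarith)
      _ = |t| ^ q * 2 ^ q := Real.mul_rpow ht (by norm_num)
      _ ≤ _ := by gcongr; linarith

lemma lintegral_comp_mul_left {c : ℝ} (hc : c ≠ 0) {f : ℝ → ℝ≥0∞} (hf : Measurable f) :
    ∫⁻ x, f (c * x) = ENNReal.ofReal |c⁻¹| * ∫⁻ x, f x := by
  rw [← lintegral_map hf (measurable_const_mul c), Real.map_volume_mul_left hc,
    lintegral_smul_measure, smul_eq_mul]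

/-- Drop the `1`, factor out `|a| ^ p`, bound what is left below by `1 + |c * t| ^ q` and rescale.
-/
lemma lintegral_inv_weight_le {p q : ℝ} (hpq : p.HolderConjugate q) {a : ℝ} (ha : a ≠ 0) :
    ∫⁻ t : ℝ, (ENNReal.ofReal (1 + |a| ^ p + |t| ^ q))⁻¹ ≤
      (∫⁻ t : ℝ, (ENNReal.ofReal (1 + |t| ^ q))⁻¹) / ENNReal.ofReal |a| := by
  have ha' : 0 < |a| := abs_pos.2 ha
  -- Chosen so that `c ^ q = |a| ^ (-p)`, as `(1 - p) * q = -p` for conjugate exponents. The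
  -- Jacobian `c⁻¹` then leaves exactly `|a|⁻¹`.
  set c : ℝ := |a| ^ (1 - p) with hc
  have hc0 : 0 < c := Real.rpow_pos_of_pos ha' _
  have hq := hpq.symm.pos
  have e1 : c ^ q = |a| ^ (-p) := by
    rw [hc, ← Real.rpow_mul ha'.le]
    congr 1
    have := hpq.mul_eq_add
    linarith
  have e2 : |c⁻¹| * (|a| ^ (-p)) = |a|⁻¹ := by
    rw [abs_of_pos (inv_pos.2 hc0), hc, ← Real.rpow_neg ha'.le, ← Real.rpow_add ha',
      ← Real.rpow_neg_one]
    congr 1; ring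
  have hm : Measurable fun t : ℝ => (ENNReal.ofReal (1 + |t| ^ q))⁻¹ := by fun_prop
  have h := lintegral_comp_mul_left hc0.ne' hm
  calc ∫⁻ t : ℝ, (ENNReal.ofReal (1 + |a| ^ p + |t| ^ q))⁻¹
      ≤ ∫⁻ t : ℝ, ENNReal.ofReal (|a| ^ (-p)) * (ENNReal.ofReal (1 + |c * t| ^ q))⁻¹ := by
        refine lintegral_mono fun t => ?_
        have h1 : 0 < 1 + |a| ^ p + |t| ^ q := by positivity
        have h2 : 0 < 1 + |c * t| ^ q := by positivity
        rw [← ENNReal.ofReal_inv_of_pos h1, ← ENNReal.ofReal_inv_of_pos h2,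
          ← ENNReal.ofReal_mul (by positivity)]
        apply ENNReal.ofReal_le_ofReal
        rw [← div_eq_mul_inv, inv_le_comm₀ h1 (by positivity), inv_div,
          abs_mul, abs_of_pos hc0, Real.mul_rpow hc0.le (abs_nonneg t), e1,
          div_le_iff₀ (by positivity)]
        have h3 : |a| ^ p * |a| ^ (-p) = 1 := by
          rw [← Real.rpow_add ha']; simp
        have h4 : 0 < |a| ^ (-p) := by positivity
        nlinarith
    _ = ENNReal.ofReal (|a| ^ (-p)) * (ENNReal.ofReal |c⁻¹| *
          ∫⁻ t : ℝ, (ENNReal.ofReal (1 + |t| ^ q))⁻¹) := by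
        rw [lintegral_const_mul _ (by fun_prop), h]
    _ = _ := by
        rw [← mul_assoc, ← ENNReal.ofReal_mul (by positivity), mul_comm (|a| ^ (-p)), e2,
          ENNReal.ofReal_inv_of_pos ha', mul_comm, ENNReal.div_eq_inv_mul, mul_comm]

end Kernel

/-! ### The inverse Fourier integral in product coordinates. -/

lemma enorm_fourierChar (s : ℝ) : ‖(𝐞 s : ℂ)‖ₑ = 1 := by
  rw [← ofReal_norm, Circle.norm_coe, ENNReal.ofReal_one]

/-- The inverse Fourier integral of a function on `ℝ × ℝ`. -/
noncomputable def prodFourierInv (F : ℝ × ℝ → ℂ) (x : ℝ × ℝ) : ℂ :=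
  ∫ ξ : ℝ × ℝ, 𝐞 (ξ.1 * x.1 + ξ.2 * x.2) • F ξ

lemma integrable_fourierChar_smul {F : ℝ × ℝ → ℂ} (hF : Integrable F) (x : ℝ × ℝ) :
    Integrable fun ξ : ℝ × ℝ => 𝐞 (ξ.1 * x.1 + ξ.2 * x.2) • F ξ := by
  refine (integrable_norm_iff (by
    have : Continuous fun ξ : ℝ × ℝ => (𝐞 (ξ.1 * x.1 + ξ.2 * x.2) : ℂ) := by fun_prop
    exact this.aestronglyMeasurable.smul hF.aestronglyMeasurable)).1 ?_
  simpa using hF.norm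

lemma continuous_prodFourierInv {F : ℝ × ℝ → ℂ} (hF : Integrable F) :
    Continuous (prodFourierInv F) := by
  refine continuous_of_dominated (bound := fun ξ => ‖F ξ‖)
    (fun x => (integrable_fourierChar_smul hF x).aestronglyMeasurable)
    (fun x => .of_forall fun ξ => by simp) hF.norm (.of_forall fun ξ => ?_)
  simp only [Circle.smul_def]
  fun_prop

lemma prodFourierInv_add {F G : ℝ × ℝ → ℂ} (hF : Integrable F) (hG : Integrable G) (x : ℝ × ℝ) :
    prodFourierInv (F + G) x = prodFourierInv F x + prodFourierInv G x := by
  simp only [prodFourierInv, Pi.add_apply, smul_add]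
  exact integral_add (integrable_fourierChar_smul hF x) (integrable_fourierChar_smul hG x)

lemma prodFourierInv_swap (F : ℝ × ℝ → ℂ) (x : ℝ × ℝ) :
    prodFourierInv (fun ξ => F ξ.swap) x = prodFourierInv F x.swap := by
  simp only [prodFourierInv]
  have := (Measure.measurePreserving_swap (μ := (volume : Measure ℝ))
    (ν := (volume : Measure ℝ))).integral_comp MeasurableEquiv.prodComm.measurableEmbedding
    (fun ξ : ℝ × ℝ => 𝐞 (ξ.1 * x.swap.1 + ξ.2 * x.swap.2) • F ξ)
  rw [← Measure.volume_eq_prod] at this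
  rw [← this]
  simp [add_comm]

lemma lintegral_swap (f : ℝ × ℝ → ℝ≥0∞) : ∫⁻ ξ : ℝ × ℝ, f ξ.swap = ∫⁻ ξ, f ξ :=
  (Measure.measurePreserving_swap (μ := (volume : Measure ℝ))
    (ν := (volume : Measure ℝ))).lintegral_comp_emb MeasurableEquiv.prodComm.measurableEmbedding f

/-! ### Low- and high-frequency estimates for a critical weight. -/

/-- `W` is a finite positive weight on the plane whose inverse has integral at most `K / |a|` over
the vertical line with abscissa `a`. -/
structure IsCriticalWeight (W : ℝ × ℝ → ℝ≥0∞) (K : ℝ≥0∞) : Prop where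
  measurable : Measurable W
  ne_zero : ∀ ξ, W ξ ≠ 0
  ne_top : ∀ ξ, W ξ ≠ ∞
  lintegral_inv_le : ∀ a : ℝ, a ≠ 0 → ∫⁻ t : ℝ, (W (a, t))⁻¹ ≤ K / ENNReal.ofReal |a|

namespace IsCriticalWeight

variable {W : ℝ × ℝ → ℝ≥0∞} {K : ℝ≥0∞} {R : ℝ}

/-- Cauchy–Schwarz leaves the integral of `|ξ₁| ^ 2 / W` over the strip `|ξ₁| ≤ R`. Each vertical
line contributes at most `|ξ₁| * K ≤ R * K`, and the strip has width `2 * R`. -/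
lemma sq_lintegral_abs_fst_mul_le (hW : IsCriticalWeight W K) (hR : 0 < R)
    {f : ℝ × ℝ → ℝ≥0∞} (hf : Measurable f) (hf0 : ∀ ξ, R < |ξ.1| → f ξ = 0) :
    (∫⁻ ξ : ℝ × ℝ, ENNReal.ofReal |ξ.1| * f ξ) ^ 2 ≤
      ENNReal.ofReal (2 * R ^ 2) * K * ∫⁻ ξ, f ξ ^ 2 * W ξ := by
  have hWm := hW.measurable
  set g : ℝ → ℝ≥0∞ := (Set.Icc (-R) R).indicator fun s => ENNReal.ofReal |s| with hg
  have hgm : Measurable g := Measurable.indicator (by fun_prop) measurableSet_Icc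
  have h1 : ∀ ξ : ℝ × ℝ, ENNReal.ofReal |ξ.1| * f ξ = g ξ.1 * f ξ := by
    intro ξ
    by_cases h : |ξ.1| ≤ R
    · rw [hg, Set.indicator_of_mem (Set.mem_Icc.2 (abs_le.1 h))]
    · rw [hf0 ξ (not_le.1 h), mul_zero, mul_zero]
  simp_rw [h1]
  refine (sq_lintegral_mul_le hf.aemeasurable (hgm.comp measurable_fst).aemeasurable
    hWm.aemeasurable hW.ne_zero hW.ne_top).trans ?_
  gcongr
  rw [Measure.volume_eq_prod, lintegral_prod _ (by fun_prop)]
  calc ∫⁻ s : ℝ, ∫⁻ t : ℝ, g s ^ 2 * (W (s, t))⁻¹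
      ≤ ∫⁻ s : ℝ, (Set.Icc (-R) R).indicator (fun _ => ENNReal.ofReal R * K) s := by
        refine lintegral_mono fun s => ?_
        rw [lintegral_const_mul _ (by fun_prop)]
        by_cases hs : s ∈ Set.Icc (-R) R
        · rw [hg, Set.indicator_of_mem hs, Set.indicator_of_mem hs]
          -- The line integral is uncontrolled at abscissa `0`, but there the factor `|s| ^ 2`
          -- vanishes.
          rcases eq_or_ne s 0 with rfl | hs0
          · simp
          · have hp : ENNReal.ofReal |s| ≠ 0 := by simpa using hs0
            calc ENNReal.ofReal |s| ^ 2 * ∫⁻ t, (W (s, t))⁻¹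
                ≤ ENNReal.ofReal |s| ^ 2 * (K / ENNReal.ofReal |s|) := by
                  gcongr; exact hW.lintegral_inv_le s hs0
              _ = ENNReal.ofReal |s| * K := by
                  rw [sq, mul_assoc, ENNReal.mul_div_cancel hp ENNReal.ofReal_ne_top]
              _ ≤ _ := by gcongr; exact abs_le.2 hs
        · simp [hg, Set.indicator_of_notMem hs]
    _ = _ := by
        rw [lintegral_indicator measurableSet_Icc, setLIntegral_const, Real.volume_Icc,
          mul_right_comm, ← ENNReal.ofReal_mul hR.le]
        congr 2; ring

/-- For fixed `y` the function of `x` is the one-dimensional inverse transform of `G`, the partial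
integral in the second frequency. Plancherel reduces the claim to a pointwise bound of `G`, which
Cauchy–Schwarz gives with `K / |s| ≤ K / R`. -/
lemma lintegral_fst_enorm_sq_prodFourierInv_le (hW : IsCriticalWeight W K) (hR : 0 < R)
    {F : ℝ × ℝ → ℂ} (hFm : Measurable F) (hF : Integrable F)
    (hF0 : ∀ ξ, |ξ.1| ≤ R → F ξ = 0) (y : ℝ) :
    ∫⁻ x, ‖prodFourierInv F (x, y)‖ₑ ^ 2 ≤
      K / ENNReal.ofReal R * ∫⁻ ξ, ‖F ξ‖ₑ ^ 2 * W ξ := by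
  have hWm := hW.measurable
  set G : ℝ → ℂ := fun s => ∫ t, 𝐞 (t * y) • F (s, t) with hG
  have hFy : Integrable fun ξ : ℝ × ℝ => 𝐞 (ξ.2 * y) • F ξ := by
    simpa using integrable_fourierChar_smul hF (0, y)
  have hGi : Integrable G := hFy.integral_prod_left
  have e1 : ∀ x, prodFourierInv F (x, y) = 𝓕⁻ G x := by
    intro x
    have h1 := integrable_fourierChar_smul hF (x, y)
    rw [prodFourierInv, Measure.volume_eq_prod, integral_prod _ h1, Real.fourierInv_eq]
    refine integral_congr_ae (.of_forall fun s => ?_)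
    simp only [hG, Circle.smul_def]
    rw [← integral_smul]
    refine integral_congr_ae (.of_forall fun t => ?_)
    simp [AddChar.map_add_eq_mul, mul_comm, mul_left_comm]
  have e2 : ∀ s, ‖G s‖ₑ ^ 2 ≤ K / ENNReal.ofReal R * ∫⁻ t, ‖F (s, t)‖ₑ ^ 2 * W (s, t) := by
    intro s
    by_cases hs : |s| ≤ R
    · have : G s = 0 := by simp [hG, hF0 (s, _) hs]
      simp [this]
    push Not at hs
    have hs0 : s ≠ 0 := abs_pos.1 (hR.trans hs)
    -- The factor `1` plays the role of `g` in `sq_lintegral_mul_le`.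
    have h2 : ‖G s‖ₑ ≤ ∫⁻ t, 1 * ‖F (s, t)‖ₑ := by
      refine (enorm_integral_le_lintegral_enorm _).trans (lintegral_mono fun t => ?_)
      simp [Circle.smul_def, enorm_mul, enorm_fourierChar]
    have hFs : Measurable fun t => F (s, t) := hFm.comp measurable_prodMk_left
    calc ‖G s‖ₑ ^ 2 ≤ (∫⁻ t, 1 * ‖F (s, t)‖ₑ) ^ 2 := pow_le_pow_left' h2 2
      _ ≤ (∫⁻ t, 1 ^ 2 * (W (s, t))⁻¹) * ∫⁻ t, ‖F (s, t)‖ₑ ^ 2 * W (s, t) :=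
          sq_lintegral_mul_le (by fun_prop) (by fun_prop)
            (by fun_prop) (fun _ => hW.ne_zero _) (fun _ => hW.ne_top _)
      _ ≤ _ := by
          gcongr
          simp only [one_pow, one_mul]
          refine (hW.lintegral_inv_le s hs0).trans ?_
          gcongr
  simp_rw [e1]
  refine (lintegral_enorm_sq_fourierInv_le hGi).trans ((lintegral_mono e2).trans ?_)
  rw [lintegral_const_mul _ (by fun_prop), Measure.volume_eq_prod,
    lintegral_prod _ (by fun_prop)]

end IsCriticalWeight

lemma enorm_fourierChar_sub_fourierChar_le (s t : ℝ) :
    ‖(𝐞 s : ℂ) - 𝐞 t‖ₑ ≤ ENNReal.ofReal (2 * Real.pi * |s - t|) := by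
  have h : (𝐞 s : ℂ) - 𝐞 t = 𝐞 t * ((𝐞 (s - t) : ℂ) - 1) := by
    rw [mul_sub, ← Circle.coe_mul, ← AddChar.map_add_eq_mul]; simp
  have h2 : (𝐞 (s - t) : ℂ) = Complex.exp (Complex.I * ((2 * Real.pi * (s - t) : ℝ) : ℂ)) := by
    rw [Real.fourierChar_apply, mul_comm]
  rw [h, enorm_mul, h2]
  refine (mul_le_mul_right (Real.enorm_exp_I_mul_ofReal_sub_one_le) _).trans ?_
  rw [enorm_fourierChar, one_mul, ← ofReal_norm]
  simp [abs_of_pos Real.pi_pos]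

lemma enorm_prodFourierInv_sub_le_lintegral {F : ℝ × ℝ → ℂ} (hF : Integrable F) {r : ℝ} (hr : 0 ≤ r)
    {x y : ℝ × ℝ} (h1 : |x.1 - y.1| ≤ r) (h2 : |x.2 - y.2| ≤ r) :
    ‖prodFourierInv F x - prodFourierInv F y‖ₑ ≤ ENNReal.ofReal (2 * Real.pi * r) *
      ∫⁻ ξ : ℝ × ℝ, (ENNReal.ofReal |ξ.1| * ‖F ξ‖ₑ + ENNReal.ofReal |ξ.2| * ‖F ξ‖ₑ) := by
  rw [prodFourierInv, prodFourierInv, ← integral_sub (integrable_fourierChar_smul hF x)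
    (integrable_fourierChar_smul hF y), ← lintegral_const_mul' _ _ ENNReal.ofReal_ne_top]
  refine (enorm_integral_le_lintegral_enorm _).trans (lintegral_mono fun ξ => ?_)
  simp only [Circle.smul_def]
  rw [← sub_smul, smul_eq_mul, enorm_mul, ← add_mul, ← mul_assoc,
    ← ENNReal.ofReal_add (abs_nonneg _) (abs_nonneg _), ← ENNReal.ofReal_mul (by positivity)]
  gcongr
  refine (enorm_fourierChar_sub_fourierChar_le _ _).trans (ENNReal.ofReal_le_ofReal ?_)
  rw [mul_assoc (2 * Real.pi)]
  gcongr
  calc |ξ.1 * x.1 + ξ.2 * x.2 - (ξ.1 * y.1 + ξ.2 * y.2)|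
      = |ξ.1 * (x.1 - y.1) + ξ.2 * (x.2 - y.2)| := by congr 1; ring
    _ ≤ |ξ.1| * |x.1 - y.1| + |ξ.2| * |x.2 - y.2| := by
        rw [← abs_mul, ← abs_mul]; exact abs_add_le _ _
    _ ≤ |ξ.1| * r + |ξ.2| * r := by gcongr
    _ = _ := by ring

/-- With cut-off `l⁻¹` the gradient is of order `l⁻¹ * (K * N) ^ (1 / 2)`, and the displacement `l`
cancels `l⁻¹`. -/
lemma IsCriticalWeight.enorm_prodFourierInv_sub_le {W : ℝ × ℝ → ℝ≥0∞} {K : ℝ≥0∞} {l : ℝ}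
    (hW : IsCriticalWeight W K) (hW' : IsCriticalWeight (fun ξ => W ξ.swap) K) (hl : 0 < l)
    {F : ℝ × ℝ → ℂ} (hFm : Measurable F) (hF : Integrable F)
    (hF0 : ∀ ξ, l⁻¹ < |ξ.1| ∨ l⁻¹ < |ξ.2| → F ξ = 0)
    {x y : ℝ × ℝ} (h1 : |x.1 - y.1| ≤ l) (h2 : |x.2 - y.2| ≤ l) :
    ‖prodFourierInv F x - prodFourierInv F y‖ₑ ≤
      20 * (K * ∫⁻ ξ, ‖F ξ‖ₑ ^ 2 * W ξ) ^ (1 / 2 : ℝ) := by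
  set N := ∫⁻ ξ, ‖F ξ‖ₑ ^ 2 * W ξ with hN
  have hl' : 0 < l⁻¹ := inv_pos.2 hl
  have a1 := hW.sq_lintegral_abs_fst_mul_le hl' (f := fun ξ => ‖F ξ‖ₑ) (by fun_prop)
    (fun ξ h => by simp [hF0 ξ (.inl h)])
  have a2 := hW'.sq_lintegral_abs_fst_mul_le hl' (f := fun ξ => ‖F ξ.swap‖ₑ) (by fun_prop)
    (fun ξ h => by simp [hF0 ξ.swap (.inr h)])
  rw [lintegral_swap (fun ξ => ‖F ξ‖ₑ ^ 2 * W ξ)] at a2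
  have a3 := lintegral_swap (fun ξ => ENNReal.ofReal |ξ.2| * ‖F ξ‖ₑ)
  simp only [Prod.snd_swap] at a3
  rw [a3] at a2
  rw [← hN] at a1 a2
  have e3 : ∀ {u v : ℝ≥0∞}, u ^ 2 ≤ v → u ≤ v ^ (1 / 2 : ℝ) := by
    intro u v h
    calc u = (u ^ 2) ^ (1 / 2 : ℝ) := by rw [← ENNReal.rpow_two, ← ENNReal.rpow_mul]; simp
      _ ≤ _ := ENNReal.rpow_le_rpow h (by norm_num)
  have e4 : (ENNReal.ofReal (2 * l⁻¹ ^ 2) * K * N) ^ (1 / 2 : ℝ) =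
      ENNReal.ofReal (√2 * l⁻¹) * (K * N) ^ (1 / 2 : ℝ) := by
    rw [mul_assoc, ENNReal.mul_rpow_of_nonneg _ _ (by norm_num),
      ENNReal.ofReal_rpow_of_nonneg (by positivity) (by norm_num), ← Real.sqrt_eq_rpow,
      Real.sqrt_mul (by norm_num), Real.sqrt_sq hl'.le]
  replace a1 := (e3 a1).trans_eq e4
  replace a2 := (e3 a2).trans_eq e4
  refine (enorm_prodFourierInv_sub_le_lintegral hF hl.le h1 h2).trans ?_
  rw [lintegral_add_left (by fun_prop)]
  calc _ ≤ ENNReal.ofReal (2 * Real.pi * l) *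
        (ENNReal.ofReal (√2 * l⁻¹) * (K * N) ^ (1 / 2 : ℝ) +
          ENNReal.ofReal (√2 * l⁻¹) * (K * N) ^ (1 / 2 : ℝ)) := by gcongr
    _ = ENNReal.ofReal (4 * Real.pi * √2) * (K * N) ^ (1 / 2 : ℝ) := by
        rw [← two_mul, ← mul_assoc, ← mul_assoc, ← ENNReal.ofReal_ofNat 2,
          ← ENNReal.ofReal_mul (by positivity), ← ENNReal.ofReal_mul (by positivity)]
        congr 2; field_simp; norm_num
    -- The constant is `4π√2 < 20`.
    _ ≤ _ := by
        gcongr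
        rw [← ENNReal.ofReal_ofNat 20]
        apply ENNReal.ofReal_le_ofReal
        have := Real.pi_lt_d2
        have h2 : √2 ≤ 1.5 := by rw [Real.sqrt_le_left (by norm_num)]; norm_num
        nlinarith [Real.pi_pos, Real.sqrt_nonneg 2]

/-! ### Averages and mean oscillation over squares. -/

lemma lintegral_square_le {a b l : ℝ} {f : ℝ × ℝ → ℝ≥0∞} (hf : Measurable f) {B : ℝ≥0∞}
    (hB : ∀ y, ∫⁻ x, f (x, y) ≤ B) :
    ∫⁻ z in Set.Icc a (a + l) ×ˢ Set.Icc b (b + l), f z ≤ B * ENNReal.ofReal l := by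
  rw [Measure.volume_eq_prod, ← Measure.prod_restrict, lintegral_prod_symm _ hf.aemeasurable]
  calc _ ≤ ∫⁻ _ in Set.Icc b (b + l), B :=
        lintegral_mono fun y => (setLIntegral_le_lintegral _ _).trans (hB y)
    _ = _ := by simp

lemma lintegral_le_sqrt_lintegral_sq {α : Type*} [MeasurableSpace α] {P : Measure α} [IsProbabilityMeasure P]
    {f : α → ℝ≥0∞} (hf : AEMeasurable f P) :
    ∫⁻ x, f x ∂P ≤ (∫⁻ x, f x ^ 2 ∂P) ^ (1 / 2 : ℝ) := by
  have h := sq_lintegral_mul_le (μ := P) hf (g := fun _ => 1) (w := fun _ => 1)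
    (by fun_prop) (by fun_prop) (by simp) (by simp)
  simp only [one_mul, one_pow, inv_one, lintegral_const, measure_univ, mul_one] at h
  calc _ = ((∫⁻ x, f x ∂P) ^ 2) ^ (1 / 2 : ℝ) := by
        rw [← ENNReal.rpow_two, ← ENNReal.rpow_mul]; simp
    _ ≤ _ := ENNReal.rpow_le_rpow h (by norm_num)

lemma volume_square (a b : ℝ) {l : ℝ} (hl : 0 < l) :
    volume (Set.Icc a (a + l) ×ˢ Set.Icc b (b + l)) = ENNReal.ofReal (l ^ 2) := by
  rw [Measure.volume_eq_prod, Measure.prod_prod, Real.volume_Icc, Real.volume_Icc,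
    ← ENNReal.ofReal_mul (by linarith)]
  congr 1; ring

lemma isProbabilityMeasure_restrict_square (a b : ℝ) {l : ℝ} (hl : 0 < l) :
    IsProbabilityMeasure
      ((volume.restrict (Set.Icc a (a + l) ×ˢ Set.Icc b (b + l)) Set.univ)⁻¹ •
        volume.restrict (Set.Icc a (a + l) ×ˢ Set.Icc b (b + l))) := by
  constructor
  simp only [Measure.smul_apply, Measure.restrict_apply_univ, smul_eq_mul, volume_square a b hl]
  exact ENNReal.inv_mul_cancel (by simp [hl.ne']) ENNReal.ofReal_ne_top

/-- By Jensen it suffices to bound the mean square. Each horizontal line gives a factor `l`,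
integration over the height gives another, and the area `l ^ 2` cancels both. -/
lemma IsCriticalWeight.laverage_square_le {W : ℝ × ℝ → ℝ≥0∞} {K : ℝ≥0∞} {a b l : ℝ}
    (hW : IsCriticalWeight W K) (hl : 0 < l) {F : ℝ × ℝ → ℂ} (hFm : Measurable F)
    (hF : Integrable F) (hF0 : ∀ ξ, |ξ.1| ≤ l⁻¹ → F ξ = 0) :
    ⨍⁻ z in Set.Icc a (a + l) ×ˢ Set.Icc b (b + l), ‖prodFourierInv F z‖ₑ ∂volume ≤
      (K * ∫⁻ ξ, ‖F ξ‖ₑ ^ 2 * W ξ) ^ (1 / 2 : ℝ) := by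
  have := isProbabilityMeasure_restrict_square a b hl
  have hm := (continuous_prodFourierInv hF).measurable
  refine (lintegral_le_sqrt_lintegral_sq (by fun_prop)).trans (ENNReal.rpow_le_rpow ?_ (by norm_num))
  rw [lintegral_smul_measure, Measure.restrict_apply_univ, volume_square a b hl, smul_eq_mul]
  refine (mul_le_mul_right (lintegral_square_le (by fun_prop)
    (hW.lintegral_fst_enorm_sq_prodFourierInv_le (inv_pos.2 hl) hFm hF hF0)) _).trans_eq ?_
  rw [ENNReal.ofReal_inv_of_pos hl, ENNReal.div_eq_inv_mul, inv_inv, ENNReal.ofReal_pow hl.le]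
  set L := ENNReal.ofReal l with hL
  have h1 : (L ^ 2)⁻¹ * L ^ 2 = 1 := ENNReal.inv_mul_cancel (by simp [hL, hl]) (by simp [hL])
  calc _ = ((L ^ 2)⁻¹ * L ^ 2) * (K * ∫⁻ ξ, ‖F ξ‖ₑ ^ 2 * W ξ) := by ring
    _ = _ := by rw [h1, one_mul]

lemma setLAverage_square_swap {a b l : ℝ} (f : ℝ × ℝ → ℝ≥0∞) :
    ⨍⁻ z in Set.Icc a (a + l) ×ˢ Set.Icc b (b + l), f z ∂volume =
      ⨍⁻ z in Set.Icc b (b + l) ×ˢ Set.Icc a (a + l), f z.swap ∂volume := by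
  have hs : MeasurePreserving (Prod.swap : ℝ × ℝ → ℝ × ℝ) volume volume :=
    Measure.measurePreserving_swap (μ := (volume : Measure ℝ)) (ν := (volume : Measure ℝ))
  have he : MeasurableEmbedding (Prod.swap : ℝ × ℝ → ℝ × ℝ) :=
    MeasurableEquiv.prodComm.measurableEmbedding
  rw [setLAverage_eq, setLAverage_eq, ← hs.setLIntegral_comp_preimage_emb he f,
    ← hs.measure_preimage_emb he (Set.Icc a (a + l) ×ˢ Set.Icc b (b + l)), Set.preimage_swap_prod]

/-- The mean oscillation over a square of the inverse Fourier transform of `F` is controlled by the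
weighted `L²` norm of `F`. -/
lemma IsCriticalWeight.setLAverage_enorm_sub_le {W : ℝ × ℝ → ℝ≥0∞} {K : ℝ≥0∞} {a b l : ℝ}
    (hW : IsCriticalWeight W K) (hW' : IsCriticalWeight (fun ξ => W ξ.swap) K) (hl : 0 < l)
    {F : ℝ × ℝ → ℂ} (hFm : Measurable F) (hF : Integrable F) :
    ⨍⁻ x in Set.Icc a (a + l) ×ˢ Set.Icc b (b + l), ‖prodFourierInv F x -
      ⨍ y in Set.Icc a (a + l) ×ˢ Set.Icc b (b + l), prodFourierInv F y ∂volume‖ₑ ∂volume ≤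
      24 * (K * ∫⁻ ξ, ‖F ξ‖ₑ ^ 2 * W ξ) ^ (1 / 2 : ℝ) := by
  set Q := Set.Icc a (a + l) ×ˢ Set.Icc b (b + l) with hQ
  have hQm : MeasurableSet Q := measurableSet_Icc.prod measurableSet_Icc
  have hP := isProbabilityMeasure_restrict_square a b hl
  rw [← hQ] at hP
  -- A partition of the frequency plane: both coordinates low, first high, only second high.
  set S₁ : Set (ℝ × ℝ) := {ξ | |ξ.1| ≤ l⁻¹ ∧ |ξ.2| ≤ l⁻¹} with hS₁
  set S₂ : Set (ℝ × ℝ) := {ξ | l⁻¹ < |ξ.1|} with hS₂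
  set S₃ : Set (ℝ × ℝ) := {ξ | |ξ.1| ≤ l⁻¹ ∧ l⁻¹ < |ξ.2|} with hS₃
  have m₁ : MeasurableSet S₁ :=
    (measurableSet_le (f := fun ξ : ℝ × ℝ => |ξ.1|) (g := fun _ => l⁻¹) (by fun_prop)
      (by fun_prop)).inter (measurableSet_le (f := fun ξ : ℝ × ℝ => |ξ.2|) (g := fun _ => l⁻¹)
        (by fun_prop) (by fun_prop))
  have m₂ : MeasurableSet S₂ := measurableSet_lt (by fun_prop) (by fun_prop)
  have m₃ : MeasurableSet S₃ :=
    (measurableSet_le (f := fun ξ : ℝ × ℝ => |ξ.1|) (g := fun _ => l⁻¹) (by fun_prop)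
      (by fun_prop)).inter (measurableSet_lt (f := fun _ => l⁻¹) (g := fun ξ : ℝ × ℝ => |ξ.2|)
        (by fun_prop) (by fun_prop))
  set N := ∫⁻ ξ, ‖F ξ‖ₑ ^ 2 * W ξ with hN
  have hNle : ∀ S : Set (ℝ × ℝ), (K * ∫⁻ ξ, ‖S.indicator F ξ‖ₑ ^ 2 * W ξ) ^ (1 / 2 : ℝ) ≤
      (K * N) ^ (1 / 2 : ℝ) := by
    intro S
    refine ENNReal.rpow_le_rpow ?_ (by norm_num)
    rw [hN]
    gcongr with ξ
    exact enorm_indicator_le_enorm_self _ _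
  have i₁ := hF.indicator m₁
  have i₂ := hF.indicator m₂
  have i₃ := hF.indicator m₃
  have hsplit : F = S₁.indicator F + (S₂.indicator F + S₃.indicator F) := by
    ext ξ
    by_cases h1 : |ξ.1| ≤ l⁻¹ <;> by_cases h2 : |ξ.2| ≤ l⁻¹ <;>
      simp [hS₁, hS₂, hS₃, Set.indicator, h1, h2, not_lt.2, not_le.1]
  have hadd : ∀ z, prodFourierInv F z = prodFourierInv (S₁.indicator F) z +
      (prodFourierInv (S₂.indicator F) z + prodFourierInv (S₃.indicator F) z) := by
    intro z
    rw [← prodFourierInv_add i₂ i₃, ← prodFourierInv_add i₁ (i₂.add i₃), ← hsplit]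
  have hint : ∀ {G : ℝ × ℝ → ℂ}, Integrable G →
      Integrable (prodFourierInv G) ((volume.restrict Q Set.univ)⁻¹ • volume.restrict Q) := by
    intro G hG
    refine Integrable.smul_measure ?_ ?_
    · exact (continuous_prodFourierInv hG).continuousOn.integrableOn_compact
        (isCompact_Icc.prod isCompact_Icc)
    · rw [Measure.restrict_apply_univ, volume_square a b hl]; simp [hl.ne']
  have hQae : ∀ᵐ x ∂((volume.restrict Q Set.univ)⁻¹ • volume.restrict Q), x ∈ Q :=
    Measure.ae_smul_measure (ae_restrict_mem hQm) _
  have b₁ : ⨍⁻ x in Q, ‖prodFourierInv (S₁.indicator F) x -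
      ⨍ y in Q, prodFourierInv (S₁.indicator F) y ∂volume‖ₑ ∂volume ≤ 20 * (K * N) ^ (1 / 2 : ℝ) := by
    refine lintegral_enorm_sub_integral_le_of_forall (hint i₁) hQae fun x hx y hy => ?_
    refine (hW.enorm_prodFourierInv_sub_le hW' hl (hFm.indicator m₁) i₁ ?_ ?_ ?_).trans
      (mul_le_mul_right (hNle _) _)
    · intro ξ h
      refine Set.indicator_of_notMem (fun hξ => ?_) _
      rcases h with h | h
      · exact h.not_ge hξ.1
      · exact h.not_ge hξ.2
    · rw [abs_le]; constructor <;> linarith [hx.1.1, hx.1.2, hy.1.1, hy.1.2]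
    · rw [abs_le]; constructor <;> linarith [hx.2.1, hx.2.2, hy.2.1, hy.2.2]
  have b₂ : ⨍⁻ x in Q, ‖prodFourierInv (S₂.indicator F) x -
      ⨍ y in Q, prodFourierInv (S₂.indicator F) y ∂volume‖ₑ ∂volume ≤ 2 * (K * N) ^ (1 / 2 : ℝ) := by
    refine (lintegral_enorm_sub_integral_le_two_mul _).trans (mul_le_mul_right ?_ _)
    refine (hW.laverage_square_le hl (hFm.indicator m₂) i₂ ?_).trans (hNle _)
    exact fun ξ h => Set.indicator_of_notMem (fun hξ : ξ ∈ S₂ => (show l⁻¹ < |ξ.1| from hξ).not_ge h) _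
  have b₃ : ⨍⁻ x in Q, ‖prodFourierInv (S₃.indicator F) x -
      ⨍ y in Q, prodFourierInv (S₃.indicator F) y ∂volume‖ₑ ∂volume ≤ 2 * (K * N) ^ (1 / 2 : ℝ) := by
    refine (lintegral_enorm_sub_integral_le_two_mul _).trans (mul_le_mul_right ?_ _)
    change ⨍⁻ x in Q, _ ∂volume ≤ _
    -- Exchanging the coordinates makes the high frequency the first one, at the price of using
    -- `hW'`.
    rw [hQ, setLAverage_square_swap]
    simp only [← prodFourierInv_swap]
    refine (hW'.laverage_square_le hl ((hFm.indicator m₃).comp measurable_swap) i₃.swap ?_).trans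
      (le_trans (le_of_eq ?_) (hNle S₃))
    · exact fun ξ h => Set.indicator_of_notMem (fun hξ => hξ.2.not_ge h) _
    · congr 2
      exact lintegral_swap fun ξ => ‖S₃.indicator F ξ‖ₑ ^ 2 * W ξ
  have c₁ := lintegral_enorm_sub_integral_add_le (hint i₂) (hint i₃)
  have c₂ := lintegral_enorm_sub_integral_add_le (hint i₁) ((hint i₂).add (hint i₃))
  simp only [hadd]
  -- The three pieces add up to `20 + 2 + 2 = 24`.
  refine c₂.trans ((add_le_add b₁ (c₁.trans (add_le_add b₂ b₃))).trans_eq ?_)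
  ring

/-! ### Transfer to the Euclidean plane. -/

/-- The identification of the Euclidean plane with `ℝ × ℝ`. -/
def planeEquiv : EuclideanSpace ℝ (Fin 2) ≃ᵐ ℝ × ℝ :=
  (MeasurableEquiv.toLp 2 (Fin 2 → ℝ)).symm.trans MeasurableEquiv.finTwoArrow

lemma planeEquiv_apply (x : EuclideanSpace ℝ (Fin 2)) : planeEquiv x = (x 0, x 1) := rfl

lemma measurePreserving_planeEquiv : MeasurePreserving planeEquiv :=
  (volume_preserving_finTwoArrow ℝ).comp (PiLp.volume_preserving_ofLp (Fin 2))

lemma cube_eq_preimage (a : EuclideanSpace ℝ (Fin 2)) (l : ℝ) :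
    cube a l = planeEquiv ⁻¹' (Set.Icc (a 0) (a 0 + l) ×ˢ Set.Icc (a 1) (a 1 + l)) := by
  ext x
  simp [cube, planeEquiv_apply, Fin.forall_fin_two]
  tauto

lemma fourierInv_eq_prodFourierInv (F : EuclideanSpace ℝ (Fin 2) → ℂ)
    (x : EuclideanSpace ℝ (Fin 2)) :
    𝓕⁻ F x = prodFourierInv (F ∘ planeEquiv.symm) (planeEquiv x) := by
  rw [Real.fourierInv_eq, prodFourierInv, ← measurePreserving_planeEquiv.integral_comp
    planeEquiv.measurableEmbedding]
  refine integral_congr_ae (.of_forall fun ξ => ?_)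
  change 𝐞 (inner ℝ ξ x) • F ξ =
    𝐞 (ξ 0 * x 0 + ξ 1 * x 1) • F (planeEquiv.symm (planeEquiv ξ))
  rw [MeasurableEquiv.symm_apply_apply]
  simp [PiLp.inner_apply, Fin.sum_univ_two, mul_comm]

lemma volume_cube (a : EuclideanSpace ℝ (Fin 2)) {l : ℝ} (hl : 0 < l) :
    volume (cube a l) = ENNReal.ofReal (l ^ 2) := by
  rw [cube_eq_preimage, measurePreserving_planeEquiv.measure_preimage_emb
    planeEquiv.measurableEmbedding, volume_square _ _ hl]

lemma isProbabilityMeasure_restrict_cube (a : EuclideanSpace ℝ (Fin 2)) {l : ℝ} (hl : 0 < l) :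
    IsProbabilityMeasure
      ((volume.restrict (cube a l) Set.univ)⁻¹ • volume.restrict (cube a l)) := by
  constructor
  simp only [Measure.smul_apply, Measure.restrict_apply_univ, smul_eq_mul, volume_cube a hl]
  exact ENNReal.inv_mul_cancel (by simp [hl.ne']) ENNReal.ofReal_ne_top

lemma meanOscillation_comp_planeEquiv (f : ℝ × ℝ → ℂ) (Q : Set (ℝ × ℝ)) :
    meanOscillation (fun x => f (planeEquiv x)) (planeEquiv ⁻¹' Q) =
      ⨍⁻ x in Q, ‖f x - ⨍ y in Q, f y ∂volume‖ₑ ∂volume := by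
  have h := measurePreserving_planeEquiv
  have he := planeEquiv.measurableEmbedding
  have h1 : ⨍ y in planeEquiv ⁻¹' Q, f (planeEquiv y) ∂volume = ⨍ y in Q, f y ∂volume := by
    rw [setAverage_eq, setAverage_eq, h.setIntegral_preimage_emb he, Measure.real,
      h.measure_preimage_emb he, Measure.real]
  rw [meanOscillation, h1, setLAverage_eq, setLAverage_eq, h.measure_preimage_emb he,
    ← h.setLIntegral_comp_preimage_emb he]

lemma meanOscillation_congr {n : ℕ} {f g : EuclideanSpace ℝ (Fin n) → ℂ} (h : f =ᵐ[volume] g)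
    (Q : Set (EuclideanSpace ℝ (Fin n))) : meanOscillation f Q = meanOscillation g Q := by
  have h' := ae_restrict_of_ae (s := Q) h
  rw [meanOscillation, meanOscillation, average_congr h']
  exact laverage_congr (by filter_upwards [h'] with x hx; rw [hx])

lemma bmoNorm_congr {n : ℕ} {f g : EuclideanSpace ℝ (Fin n) → ℂ} (h : f =ᵐ[volume] g) :
    bmoNorm f = bmoNorm g := by
  simp only [bmoNorm, meanOscillation_congr h]

/-- The weight of `S_{p,q}`. -/
noncomputable def sobolevWeight (p q : ℝ) (ξ : EuclideanSpace ℝ (Fin 2)) : ℝ≥0∞ :=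
  ENNReal.ofReal (1 + |ξ 0| ^ p + |ξ 1| ^ q)

lemma measurable_sobolevWeight (p q : ℝ) : Measurable (sobolevWeight p q) := by
  unfold sobolevWeight; fun_prop

lemma isCriticalWeight {p q : ℝ} (hpq : p.HolderConjugate q) {K : ℝ≥0∞}
    (hK : ∫⁻ t : ℝ, (ENNReal.ofReal (1 + |t| ^ q))⁻¹ ≤ K) :
    IsCriticalWeight (fun ξ => ENNReal.ofReal (1 + |ξ.1| ^ p + |ξ.2| ^ q)) K where
  measurable := by fun_prop
  ne_zero ξ := by
    have : 0 < 1 + |ξ.1| ^ p + |ξ.2| ^ q := by positivity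
    simpa using this
  ne_top ξ := ENNReal.ofReal_ne_top
  lintegral_inv_le a ha := (lintegral_inv_weight_le hpq ha).trans (by gcongr)

lemma exists_meanOscillation_fourierInv_le {p q : ℝ} (hpq : p.HolderConjugate q) :
    ∃ C : ℝ≥0, ∀ F : EuclideanSpace ℝ (Fin 2) → ℂ, Measurable F → Integrable F →
      ∀ a l, 0 < l → meanOscillation (𝓕⁻ F) (cube a l) ≤
        C * (∫⁻ ξ, ‖F ξ‖ₑ ^ 2 * sobolevWeight p q ξ) ^ (1 / 2 : ℝ) := by
  -- The sum of the two line constants serves both orders of the coordinates.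
  set K := (∫⁻ t : ℝ, (ENNReal.ofReal (1 + |t| ^ q))⁻¹) +
    ∫⁻ t : ℝ, (ENNReal.ofReal (1 + |t| ^ p))⁻¹ with hK
  have hKt : K ≠ ∞ := ENNReal.add_ne_top.2
    ⟨(lintegral_inv_one_add_abs_rpow_lt_top hpq.symm.lt).ne,
      (lintegral_inv_one_add_abs_rpow_lt_top hpq.lt).ne⟩
  have hCt : 24 * K ^ (1 / 2 : ℝ) ≠ ∞ :=
    ENNReal.mul_ne_top (by norm_num) (ENNReal.rpow_ne_top_of_nonneg (by norm_num) hKt)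
  refine ⟨(24 * K ^ (1 / 2 : ℝ)).toNNReal, fun F hFm hF a l hl => ?_⟩
  rw [ENNReal.coe_toNNReal hCt]
  have hW := isCriticalWeight hpq (K := K) le_self_add
  have hW' : IsCriticalWeight
      (fun ξ => ENNReal.ofReal (1 + |ξ.swap.1| ^ p + |ξ.swap.2| ^ q)) K := by
    have := isCriticalWeight hpq.symm (K := K) le_add_self
    simpa only [Prod.fst_swap, Prod.snd_swap, add_right_comm] using this
  have he := planeEquiv.measurableEmbedding
  have hs := measurePreserving_planeEquiv.symm
  have h := hW.setLAverage_enorm_sub_le hW' hl (a := a 0) (b := a 1)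
    (hFm.comp planeEquiv.symm.measurable) ((hs.integrable_comp_emb
      planeEquiv.symm.measurableEmbedding).2 hF)
  have e1 : (𝓕⁻ F : EuclideanSpace ℝ (Fin 2) → ℂ) =
      fun x => prodFourierInv (F ∘ planeEquiv.symm) (planeEquiv x) :=
    funext (fourierInv_eq_prodFourierInv F)
  rw [e1, cube_eq_preimage, meanOscillation_comp_planeEquiv]
  refine h.trans_eq ?_
  rw [ENNReal.mul_rpow_of_nonneg _ _ (by norm_num), mul_assoc,
    ← measurePreserving_planeEquiv.lintegral_comp_emb he]
  simp only [Function.comp_apply, MeasurableEquiv.symm_apply_apply]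
  rfl

/-- A continuous function tending to `0` at infinity is uniformly continuous; the decay is the
Riemann–Lebesgue lemma. -/
lemma uniformContinuous_fourierInv {F : EuclideanSpace ℝ (Fin 2) → ℂ} (hF : Integrable F) :
    UniformContinuous (𝓕⁻ F) := by
  have hcont : Continuous (𝓕⁻ F : EuclideanSpace ℝ (Fin 2) → ℂ) :=
    VectorFourier.fourierIntegral_continuous Real.continuous_fourierChar
      (by simp only [LinearMap.neg_apply, innerₗ_apply_apply]; fun_prop) hF
  refine hcont.uniformContinuous_of_tendsto_cocompact (x := 0) ?_
  rw [Real.fourierInv_eq_fourier_comp_neg]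
  exact tendsto_integral_exp_inner_smul_cocompact fun x => F (-x)

/-! ### Truncation of the Fourier transform. -/

open Filter Topology

lemma tendsto_lintegral_compl_closedBall {E : Type*} [NormedAddCommGroup E] [MeasurableSpace E]
    [BorelSpace E] {μ : Measure E} {h : E → ℝ≥0∞} (hm : Measurable h)
    (hfin : ∫⁻ x, h x ∂μ ≠ ∞) :
    Tendsto (fun n : ℕ => ∫⁻ x, (Metric.closedBall (0 : E) n)ᶜ.indicator h x ∂μ) atTop (𝓝 0) := by
  have := tendsto_lintegral_of_dominated_convergence (μ := μ)
    (F := fun n : ℕ => (Metric.closedBall (0 : E) n)ᶜ.indicator h) (f := fun _ => 0) h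
    (fun n => hm.indicator measurableSet_closedBall.compl)
    (fun n => .of_forall fun x => Set.indicator_le_self _ _ _) hfin
    (.of_forall fun x => ?_)
  · simpa using this
  · obtain ⟨N, hN⟩ := exists_nat_ge ‖x‖
    refine tendsto_const_nhds.congr' ?_
    filter_upwards [eventually_ge_atTop N] with n hn
    refine (Set.indicator_of_notMem ?_ _).symm
    simpa using hN.trans (by exact_mod_cast hn)

section Truncation

variable {E : Type*} [NormedAddCommGroup E] [InnerProductSpace ℝ E] [FiniteDimensional ℝ E]
  [MeasurableSpace E] [BorelSpace E]

/-- The Fourier transform of `f`, cut off outside the closed ball of radius `n`. -/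
noncomputable def truncFourier (f : Lp (α := E) ℂ 2 volume) (n : ℕ) : E → ℂ :=
  (Metric.closedBall (0 : E) n).indicator (𝓕 f : Lp (α := E) ℂ 2 volume)

variable (f : Lp (α := E) ℂ 2 volume) (n : ℕ)

lemma measurable_truncFourier : Measurable (truncFourier f n) :=
  (Lp.stronglyMeasurable _).measurable.indicator measurableSet_closedBall

lemma memLp_truncFourier : MemLp (truncFourier f n) 2 :=
  (Lp.memLp _).indicator measurableSet_closedBall

lemma integrable_truncFourier : Integrable (truncFourier f n) := by
  rw [truncFourier, integrable_indicator_iff measurableSet_closedBall]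
  have : IsFiniteMeasure (volume.restrict (Metric.closedBall (0 : E) n)) :=
    ⟨by simpa using measure_closedBall_lt_top⟩
  exact ((Lp.memLp (𝓕 f : Lp (α := E) ℂ 2 volume)).restrict _).integrable (by norm_num)

/-- The function in `L²` whose Fourier transform is that of `f`, cut off outside the closed ball of
radius `n`. -/
noncomputable def lowFreq : Lp (α := E) ℂ 2 volume :=
  𝓕⁻ ((memLp_truncFourier f n).toLp _ : Lp (α := E) ℂ 2 volume)

lemma lowFreq_ae_eq : lowFreq f n =ᵐ[volume] 𝓕⁻ (truncFourier f n) :=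
  fourierInv_toLp_ae_eq (integrable_truncFourier f n) (memLp_truncFourier f n)

/-- This turns weighted energies of the remainder into tails of one convergent integral. -/
lemma fourier_sub_lowFreq_ae_eq : (𝓕 (f - lowFreq f n) : Lp (α := E) ℂ 2 volume) =ᵐ[volume]
    (Metric.closedBall (0 : E) n)ᶜ.indicator (𝓕 f : Lp (α := E) ℂ 2 volume) := by
  have h : 𝓕 (f - lowFreq f n) = 𝓕 f - (memLp_truncFourier f n).toLp _ := by
    have := (Lp.fourierTransformₗᵢ E ℂ).map_sub f (lowFreq f n)
    refine this.trans ?_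
    congr 1
    exact (Lp.fourierTransformₗᵢ E ℂ).apply_symm_apply _
  rw [h]
  filter_upwards [Lp.coeFn_sub (𝓕 f : Lp (α := E) ℂ 2 volume) ((memLp_truncFourier f n).toLp _),
    (memLp_truncFourier f n).coeFn_toLp] with x h1 h2
  rw [h1, Pi.sub_apply, h2, truncFourier, Set.indicator_compl, Pi.sub_apply]

variable {f}

lemma tendsto_lintegral_fourier_sub_lowFreq {w : E → ℝ≥0∞} (hw : Measurable w)
    (h : ∫⁻ ξ, ‖(𝓕 f : Lp (α := E) ℂ 2 volume) ξ‖ₑ ^ 2 * w ξ ≠ ∞) :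
    Tendsto (fun n : ℕ => ∫⁻ ξ, ‖(𝓕 (f - lowFreq f n) : Lp (α := E) ℂ 2 volume) ξ‖ₑ ^ 2 * w ξ)
      atTop (𝓝 0) := by
  have hm : Measurable (𝓕 f : Lp (α := E) ℂ 2 volume) := (Lp.stronglyMeasurable _).measurable
  refine (tendsto_lintegral_compl_closedBall (by fun_prop) h).congr fun n => ?_
  refine lintegral_congr_ae ?_
  filter_upwards [fourier_sub_lowFreq_ae_eq f n] with x hx
  rw [hx]
  by_cases h : x ∈ (Metric.closedBall (0 : E) n)ᶜ
  · simp only [Set.indicator_of_mem h]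
  · simp [Set.indicator_of_notMem h]

lemma tendsto_enorm_sub_lowFreq :
    Tendsto (fun n : ℕ => ‖f - lowFreq f n‖ₑ ^ 2) atTop (𝓝 0) := by
  have e : ∀ u : Lp (α := E) ℂ 2 volume, ‖u‖ₑ = ‖𝓕 u‖ₑ := fun u => by
    rw [← ofReal_norm, ← ofReal_norm, Lp.norm_fourier_eq]
  have h := tendsto_lintegral_fourier_sub_lowFreq (f := f) (w := fun _ => 1) measurable_const (by
    simp only [mul_one, lintegral_enorm_sq_coeFn]; simp)
  simpa only [mul_one, lintegral_enorm_sq_coeFn, ← e] using h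

end Truncation

/-! ### The BMO bound and convergence in the weighted norm. -/

lemma sobolevNorm_eq (p q : ℝ) (g : L2Plane) : sobolevNorm p q g =
    (∫⁻ ξ, ‖(𝓕 g : L2Plane) ξ‖ₑ ^ 2 * sobolevWeight p q ξ) ^ (1 / 2 : ℝ) := rfl

lemma rpow_lintegral_truncFourier_le (p q : ℝ) (f : L2Plane) (n : ℕ) :
    (∫⁻ ξ, ‖truncFourier f n ξ‖ₑ ^ 2 * sobolevWeight p q ξ) ^ (1 / 2 : ℝ) ≤
      sobolevNorm p q f := by
  rw [sobolevNorm_eq]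
  refine ENNReal.rpow_le_rpow (lintegral_mono fun ξ => ?_) (by norm_num)
  gcongr
  exact enorm_indicator_le_enorm_self _ _

/-- The bound degenerates as `l → 0`, which is harmless: it is used only to pass to an `L²` limit on
a fixed cube. -/
lemma meanOscillation_le_enorm (a : EuclideanSpace ℝ (Fin 2)) {l : ℝ} (hl : 0 < l)
    (u : L2Plane) : meanOscillation u (cube a l) ≤
      2 * ((ENNReal.ofReal (l ^ 2))⁻¹ * ‖u‖ₑ ^ 2) ^ (1 / 2 : ℝ) := by
  have := isProbabilityMeasure_restrict_cube a hl
  have hm : Measurable u := (Lp.stronglyMeasurable u).measurable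
  refine (lintegral_enorm_sub_integral_le_two_mul _).trans (mul_le_mul_right ?_ _)
  refine (lintegral_le_sqrt_lintegral_sq (by fun_prop)).trans (ENNReal.rpow_le_rpow ?_ (by norm_num))
  rw [lintegral_smul_measure, Measure.restrict_apply_univ, volume_cube a hl, smul_eq_mul,
    ← lintegral_enorm_sq_coeFn]
  gcongr
  exact Measure.restrict_le_self

lemma integrable_cube (a : EuclideanSpace ℝ (Fin 2)) {l : ℝ} (hl : 0 < l) (u : L2Plane) :
    Integrable u ((volume.restrict (cube a l) Set.univ)⁻¹ • volume.restrict (cube a l)) := by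
  have := isProbabilityMeasure_restrict_cube a hl
  refine MemLp.integrable (q := 2) (by norm_num)
    (((Lp.memLp u).restrict _).smul_measure ?_)
  rw [Measure.restrict_apply_univ, volume_cube a hl]; simp [hl.ne']

lemma exists_bmoNorm_le {p q : ℝ} (hpq : p.HolderConjugate q) :
    ∃ C : ℝ≥0, (∀ f : L2Plane, bmoNorm f ≤ C * sobolevNorm p q f) ∧
      ∀ (f : L2Plane) (n : ℕ), bmoNorm (𝓕⁻ (truncFourier f n)) ≤ C * sobolevNorm p q f := by
  obtain ⟨C, hC⟩ := exists_meanOscillation_fourierInv_le hpq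
  have hn : ∀ (f : L2Plane) (n : ℕ) a l, 0 < l →
      meanOscillation (𝓕⁻ (truncFourier f n)) (cube a l) ≤ C * sobolevNorm p q f :=
    fun f n a l hl => (hC _ (measurable_truncFourier f n) (integrable_truncFourier f n) a l
      hl).trans (mul_le_mul_right (rpow_lintegral_truncFourier_le p q f n) _)
  refine ⟨C, fun f => iSup_le fun a => iSup_le fun l => iSup_le fun hl => ?_,
    fun f n => iSup_le fun a => iSup_le fun l => iSup_le fun hl => hn f n a l hl⟩
  -- The truncation obeys the bound uniformly in `n`; the remainder costs an `L²` term that vanishes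
  -- as `n → ∞` with the cube fixed.
  have hb : ∀ n : ℕ, meanOscillation f (cube a l) ≤ C * sobolevNorm p q f +
      2 * ((ENNReal.ofReal (l ^ 2))⁻¹ * ‖f - lowFreq f n‖ₑ ^ 2) ^ (1 / 2 : ℝ) := by
    intro n
    have h1 : f =ᵐ[volume] fun x => lowFreq f n x + (f - lowFreq f n : L2Plane) x := by
      filter_upwards [Lp.coeFn_sub f (lowFreq f n)] with x hx
      rw [hx, Pi.sub_apply, add_sub_cancel]
    rw [meanOscillation_congr h1]
    refine (lintegral_enorm_sub_integral_add_le (integrable_cube a hl _)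
      (integrable_cube a hl _)).trans (add_le_add ?_ (meanOscillation_le_enorm a hl _))
    exact (meanOscillation_congr (lowFreq_ae_eq f n) _).trans_le (hn f n a l hl)
  have hL : (ENNReal.ofReal (l ^ 2))⁻¹ ≠ ∞ := by simp [hl.ne']
  have ht : Tendsto (fun n : ℕ => C * sobolevNorm p q f +
      2 * ((ENNReal.ofReal (l ^ 2))⁻¹ * ‖f - lowFreq f n‖ₑ ^ 2) ^ (1 / 2 : ℝ)) atTop
      (𝓝 (C * sobolevNorm p q f + 2 * ((ENNReal.ofReal (l ^ 2))⁻¹ * 0) ^ (1 / 2 : ℝ))) :=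
    tendsto_const_nhds.add (ENNReal.Tendsto.const_mul
      ((ENNReal.continuous_rpow_const.tendsto _).comp
        (ENNReal.Tendsto.const_mul tendsto_enorm_sub_lowFreq (.inr hL))) (.inr (by norm_num)))
  simpa using ge_of_tendsto' ht hb

lemma sobolevNorm_lt_top {p q : ℝ} {f : L2Plane} (hf : f ∈ sobolevSpace p q) :
    sobolevNorm p q f < ∞ :=
  ENNReal.rpow_lt_top_of_nonneg (by norm_num) (ne_of_lt hf)

lemma tendsto_sobolevNorm_sub_lowFreq {p q : ℝ} {f : L2Plane} (hf : f ∈ sobolevSpace p q) :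
    Tendsto (fun n : ℕ => sobolevNorm p q (f - lowFreq f n)) atTop (𝓝 0) := by
  have h := (ENNReal.continuous_rpow_const (y := (1 / 2 : ℝ))).tendsto 0 |>.comp
    (tendsto_lintegral_fourier_sub_lowFreq (measurable_sobolevWeight p q) (ne_of_lt hf))
  rw [ENNReal.zero_rpow_of_pos (by norm_num)] at h
  exact h

end ZakVMO

theorem mainTheorem2 (p p' : ℝ) (hp : 1 < p) (hpp' : p.HolderConjugate p') :
    (∀ f : ZakVMO.L2Plane, f ∈ ZakVMO.sobolevSpace p p' → ZakVMO.MemVMO f) ∧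
    ∃ C : ℝ≥0, ∀ f : ZakVMO.L2Plane, f ∈ ZakVMO.sobolevSpace p p' →
      ZakVMO.bmoNorm f ≤ C * ZakVMO.sobolevNorm p p' f := by
  obtain ⟨C, hC, hC'⟩ := ZakVMO.exists_bmoNorm_le hpp'
  refine ⟨fun f hf => ?_, C, fun f _ => hC f⟩
  have hfin : C * ZakVMO.sobolevNorm p p' f < ∞ :=
    ENNReal.mul_lt_top ENNReal.coe_lt_top (ZakVMO.sobolevNorm_lt_top hf)
  refine ⟨⟨(Lp.memLp f).locallyIntegrable (by norm_num), (hC f).trans_lt hfin⟩, fun ε hε => ?_⟩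
  -- The BMO bound, applied to the remainders `f - lowFreq f n`, makes them small in BMO.
  have ht := ENNReal.Tendsto.const_mul (a := C) (ZakVMO.tendsto_sobolevNorm_sub_lowFreq hf)
    (.inr ENNReal.coe_ne_top)
  rw [mul_zero] at ht
  obtain ⟨n, hn⟩ := (ht.eventually_lt_const hε).exists
  have huc := ZakVMO.uniformContinuous_fourierInv (ZakVMO.integrable_truncFourier f n)
  refine ⟨𝓕⁻ (ZakVMO.truncFourier f n), huc,
    ⟨huc.continuous.locallyIntegrable, (hC' f n).trans_lt hfin⟩, ?_⟩
  have hae : ⇑f - 𝓕⁻ (ZakVMO.truncFourier f n) =ᵐ[volume]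
      (f - ZakVMO.lowFreq f n : ZakVMO.L2Plane) := by
    filter_upwards [Lp.coeFn_sub f (ZakVMO.lowFreq f n), ZakVMO.lowFreq_ae_eq f n] with x h1 h2
    rw [h1, Pi.sub_apply, Pi.sub_apply, h2]
  rw [ZakVMO.bmoNorm_congr hae]
  exact (hC _).trans_lt hn
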